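/- Let $G=(V,E)$ be a finite, nonempty, simple undirected graph (the current graph at step $t$). For $v\in V$ let $N(v)$ be the set consisting of $v$ and all its neighbours, and $d(v)=|N(v)|$. A clustering of $G$ is a partition of $V$ into nonempty clusters; its cost is the number of edges between different clusters plus the number of unordered pairs of distinct non-adjacent vertices in the same cluster; an optimal clustering is one of minimum cost, and $\mathrm{opt}(G)$ is that minimum. A cluster $C$ is $\eta$-good-on-average if $\sum_{u\in C}|N(u)\triangle C|\le \eta|C|^2$. A pivot step picks $u\in V$ uniformly at random, creates the cluster $C=N(u)$, and removes $C$ together with all incident edges from $G$. Let $\mathrm{ALG}_t$ be the number of edges between $C$ and $V\setminus C$ plus the number of unordered pairs of distinct non-adjacent vertices in $C$, and let $\mathrm{OPT}_t=\mathrm{opt}(G)-\mathrm{opt}(G[V\setminus C])$. Let $\varepsilon$ be a real number and let $\mathcal C^*$ be an optimal clustering of $G$. If no cluster of $\mathcal C^*$ is $\varepsilon^2$-good-on-average, then $$\mathbb E[\mathrm{ALG}_t]\le\left(3-\frac{\varepsilon^2}{\frac56\varepsilon^2+1}\right)\mathbb E[\mathrm{OPT}_t].$$ Moreover, a pivot step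 can be carried out in time $O\bigl(\sum_{v\in C}d(v)\bigr)$, where $d$ refers to the graph before the removal and the implied constant is absolute. Precisely: there is a program for a random access machine (unit-cost instructions: assignment, increment, decrement, array access, jump on equality, uniform random choice from $\{0,\dots,k-1\}$) which, started with any such $G$ stored by adjacency arrays with cross pointers between the two entries of each edge and an indexed array of the vertices present, outputs a cluster $C$ distributed as in a pivot step, leaves $G[V\setminus C]$ stored in the same way, and for every outcome of the random choices executes at most $K\sum_{v\in C}d(v)$ instructions, with $K$ an absolute constant. -/

import Mathlib

open scoped symmDiff

/-! ### Correlation clustering -/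

namespace CorrClust

section Graph

variable {V : Type*} [Fintype V] [DecidableEq V]

open Classical in
/-- The closed neighbourhood `N(v)`, which contains `v` itself. -/
noncomputable def nbhd (G : SimpleGraph V) (v : V) : Finset V :=
  Finset.univ.filter fun w => w = v ∨ G.Adj v w

/-- `d(v) = |N(v)|`, i.e. the degree plus one. -/
noncomputable def deg (G : SimpleGraph V) (v : V) : ℕ :=
  (nbhd G v).card

/-- A clustering is a partition of the vertex set into nonempty clusters. -/
abbrev Clustering (V : Type*) [Fintype V] [DecidableEq V] : Type _ :=
  Finpartition (Finset.univ : Finset V)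

/-- The cost of a clustering: edges not contained in a cluster, plus unordered pairs of
distinct nonadjacent vertices contained in a cluster. -/
noncomputable def cost (G : SimpleGraph V) (P : Clustering V) : ℕ :=
  {e : Sym2 V | e ∈ G.edgeSet ∧ ¬ ∃ C ∈ P.parts, ∀ v ∈ e, v ∈ C}.ncard +
  {e : Sym2 V | e ∈ Gᶜ.edgeSet ∧ ∃ C ∈ P.parts, ∀ v ∈ e, v ∈ C}.ncard

/-- A clustering of minimum cost. -/
def IsOptimal (G : SimpleGraph V) (P : Clustering V) : Prop :=
  ∀ Q : Clustering V, cost G P ≤ cost G Q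

/-- The minimum cost of a clustering of `G`. -/
noncomputable def optCost (G : SimpleGraph V) : ℕ :=
  sInf (Set.range (cost G))

/-- `C` is `η`-good-on-average if `∑_{u ∈ C} |N(u) △ C| ≤ η |C|²`. -/
def GoodOnAverage (G : SimpleGraph V) (η : ℝ) (C : Finset V) : Prop :=
  ((∑ u ∈ C, (nbhd G u ∆ C).card : ℕ) : ℝ) ≤ η * (C.card : ℝ) ^ 2

/-- The graph that remains when the cluster `C` and all edges incident to it are removed. -/
abbrev remaining (G : SimpleGraph V) (C : Finset V) : SimpleGraph {v : V // v ∉ C} :=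
  G.comap Subtype.val

/-- The number of constraints violated by removing `C` as a cluster: edges leaving `C`, plus
unordered pairs of distinct nonadjacent vertices inside `C`. -/
noncomputable def stepCost (G : SimpleGraph V) (C : Finset V) : ℕ :=
  {e : Sym2 V | e ∈ G.edgeSet ∧ (∃ v ∈ e, v ∈ C) ∧ ∃ v ∈ e, v ∉ C}.ncard +
  {e : Sym2 V | e ∈ Gᶜ.edgeSet ∧ ∀ v ∈ e, v ∈ C}.ncard

/-- The decrease of the cost of the optimal solution when `C` is removed. -/
noncomputable def optDecrease (G : SimpleGraph V) (C : Finset V) : ℝ :=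
  (optCost G : ℝ) - (optCost (remaining G C) : ℝ)

/-- The law of the cluster created by a pivot step: `C = N(u)` for a uniformly random `u`. -/
noncomputable def pivotStep [Nonempty V] (G : SimpleGraph V) : PMF (Finset V) :=
  (PMF.uniformOfFintype V).map (nbhd G)

/-- The expectation of `f` under a probability mass function on a finite type. -/
noncomputable def expect {α : Type*} [Fintype α] (p : PMF α) (f : α → ℝ) : ℝ :=
  ∑ a, (p a).toReal * f a

end Graph

/-! ### A randomized random access machine

The machine has registers and arrays whose cells hold natural numbers; a program is finite and
thus refers to finitely many registers and arrays.
Each instruction takes one unit of time. The only arithmetic is the addition or subtraction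
of one, so `t` steps increase the largest stored number by at most `t` (beyond the constants
of the program and the numbers that were stored at the start). -/

/-- Contents of the registers and arrays. -/
structure Memory where
  reg : ℕ → ℕ
  arr : ℕ → ℕ → ℕ

/-- The instructions. Register and array numbers are constants of the program. -/
inductive Instr where
  /-- `reg r := k` -/
  | const (r k : ℕ)
  /-- `reg r := reg s` -/
  | copy (r s : ℕ)
  /-- `reg r := reg r + 1` -/
  | inc (r : ℕ)
  /-- `reg r := reg r - 1`, where `0 - 1 = 0` -/
  | dec (r : ℕ)
  /-- `reg r := arr a [reg s]` -/
  | load (r a s : ℕ)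
  /-- `arr a [reg s] := reg r` -/
  | store (a s r : ℕ)
  /-- go to instruction `l` if `reg r = reg s` -/
  | jumpEq (r s l : ℕ)
  /-- `reg r :=` a fresh uniformly random element of `{0, …, reg s - 1}` -/
  | rand (r s : ℕ)

/-- A program is a finite list of instructions; the machine halts when the program counter
leaves the list. -/
abbrev Program : Type := List Instr

/-- Memory, program counter, and the number of instructions executed so far. -/
structure Config where
  mem : Memory
  pc : ℕ
  time : ℕ

def Memory.setReg (M : Memory) (r x : ℕ) : Memory :=
  { M with reg := Function.update M.reg r x }

def Memory.setArr (M : Memory) (a i x : ℕ) : Memory :=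
  { M with arr := Function.update M.arr a (Function.update (M.arr a) i x) }

/-- The uniform law on `{0, …, n - 1}` (the point mass at `0` if `n = 0`). -/
noncomputable def drawBelow (n : ℕ) : PMF ℕ :=
  if h : (Finset.range n).Nonempty then PMF.uniformOfFinset (Finset.range n) h else PMF.pure 0

/-- Continue with the next instruction and memory `M`. -/
def Config.next (c : Config) (M : Memory) : Config :=
  ⟨M, c.pc + 1, c.time + 1⟩

/-- The law of the configuration after executing instruction `i`. -/
noncomputable def exec (c : Config) : Instr → PMF Config
  | .const r k => PMF.pure (c.next (c.mem.setReg r k))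
  | .copy r s => PMF.pure (c.next (c.mem.setReg r (c.mem.reg s)))
  | .inc r => PMF.pure (c.next (c.mem.setReg r (c.mem.reg r + 1)))
  | .dec r => PMF.pure (c.next (c.mem.setReg r (c.mem.reg r - 1)))
  | .load r a s => PMF.pure (c.next (c.mem.setReg r (c.mem.arr a (c.mem.reg s))))
  | .store a s r => PMF.pure (c.next (c.mem.setArr a (c.mem.reg s) (c.mem.reg r)))
  | .jumpEq r s l =>
      PMF.pure ⟨c.mem, if c.mem.reg r = c.mem.reg s then l else c.pc + 1, c.time + 1⟩
  | .rand r s => (drawBelow (c.mem.reg s)).map fun x => c.next (c.mem.setReg r x)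

/-- The machine has halted. -/
def Halted (P : Program) (c : Config) : Prop :=
  P.length ≤ c.pc

/-- One step of the machine; a halted configuration does not change any more. -/
noncomputable def step (P : Program) (c : Config) : PMF Config :=
  match P[c.pc]? with
  | some i => exec c i
  | none => PMF.pure c

/-- The law of the configuration after (at most) `N` steps from memory `M`. -/
noncomputable def run (P : Program) (M : Memory) : ℕ → PMF Config
  | 0 => PMF.pure ⟨M, 0, 0⟩
  | N + 1 => (run P M N).bind (step P)

/-! ### The stored graph

Vertices are named by natural numbers. The graph is stored by adjacency arrays with cross
pointers: the entries of the adjacency array of a vertex occupy an interval of slots, and each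
slot also holds the address of the slot of the same edge at its other endpoint. The vertices
that are present are listed in an array, together with their positions in it. -/

namespace Memory

/-- The number of vertices that are present. -/
abbrev size (M : Memory) : ℕ := M.reg 0
/-- The number of vertices in the output. -/
abbrev outSize (M : Memory) : ℕ := M.reg 1
/-- The `i`-th vertex that is present. -/
abbrev vert (M : Memory) (i : ℕ) : ℕ := M.arr 0 i
/-- The position of a vertex in the array of the vertices that are present. -/
abbrev pos (M : Memory) (x : ℕ) : ℕ := M.arr 1 x
/-- The first slot of the adjacency array of a vertex. -/
abbrev first (M : Memory) (x : ℕ) : ℕ := M.arr 2 x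
/-- The slot just after the adjacency array of a vertex. -/
abbrev last (M : Memory) (x : ℕ) : ℕ := M.arr 3 x
/-- The neighbour stored in a slot. -/
abbrev target (M : Memory) (s : ℕ) : ℕ := M.arr 4 s
/-- The slot of the same edge at the other endpoint. -/
abbrev cross (M : Memory) (s : ℕ) : ℕ := M.arr 5 s
/-- The `i`-th vertex of the output. -/
abbrev out (M : Memory) (i : ℕ) : ℕ := M.arr 6 i

/-- The slots of the adjacency array of the vertex named `x`. -/
def slots (M : Memory) (x : ℕ) : Set ℕ := Set.Ico (M.first x) (M.last x)

end Memory

/-- The memory `M` stores the graph `G`, whose vertices have the given names. -/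
structure Stores {V : Type*} [Fintype V] (M : Memory) (name : V → ℕ) (G : SimpleGraph V) :
    Prop where
  name_injective : Function.Injective name
  size_eq : M.size = Fintype.card V
  vert_mem : ∀ i < M.size, ∃ v, M.vert i = name v
  pos_spec : ∀ v, M.pos (name v) < M.size ∧ M.vert (M.pos (name v)) = name v
  first_le_last : ∀ v, M.first (name v) ≤ M.last (name v)
  disjoint : ∀ v w, v ≠ w → Disjoint (M.slots (name v)) (M.slots (name w))
  target_injOn : ∀ v, Set.InjOn M.target (M.slots (name v))
  target_image : ∀ v, M.target '' M.slots (name v) = name '' G.neighborSet v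
  cross_spec : ∀ v w, ∀ s ∈ M.slots (name v), M.target s = name w →
    M.cross s ∈ M.slots (name w) ∧ M.target (M.cross s) = name v

section Output

variable {V : Type*} [Fintype V] [DecidableEq V]

open Classical in
/-- The set of the vertices listed in the output. -/
noncomputable def outCluster (name : V → ℕ) (M : Memory) : Finset V :=
  Finset.univ.filter fun v => ∃ i < M.outSize, M.out i = name v

/-- The program `P` performs a pivot step on `G` in time at most `K · ∑_{v ∈ C} d(v)`: started
in any memory that stores `G` (all other registers and cells being arbitrary), it halts for all
random choices; the cluster `C` that it outputs (without repetitions) has the law of a pivot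
step; the number of executed instructions is at most `K · ∑_{v ∈ C} d(v)`, for every outcome;
and afterwards the memory stores, under the same names, the graph from which `C` has been
removed. -/
def PerformsPivotStep [Nonempty V] (P : Program) (K : ℕ) (G : SimpleGraph V) : Prop :=
  ∀ (name : V → ℕ) (M : Memory), Stores M name G →
    ∃ N : ℕ,
      (run P M N).map (fun c => outCluster name c.mem) = pivotStep G ∧
      ∀ c ∈ (run P M N).support,
        Halted P c ∧
        (outCluster name c.mem).card = c.mem.outSize ∧
        c.time ≤ K * ∑ v ∈ outCluster name c.mem, deg G v ∧
        Stores c.mem (fun v : {v : V // v ∉ outCluster name c.mem} => name v)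
          (remaining G (outCluster name c.mem))

end Output

end CorrClust

/-! The ratio comes from charging over ordered triples (pivot, pair). Doubling the costs turns the
expected algorithmic cost and the expected decrease of the optimum into sums over all `u v w` of
`algDis` and `optDis`. For the latter, the optimum of the remaining graph is bounded by the cost of
one explicit clustering: the old optimal one with the rest of the pivot's cluster broken into
singletons (`sum_optDis_le`).

Write A and O for these two sums, d(u) for the number of disagreements at u in the optimal
clustering, D = ∑ d(u)² and S = ∑ d(u)|C(u)|, where C(u) is the cluster of u. A case check on three
vertices (`triple_inequalities`) gives A + 2D ≤ 3O and 2A ≤ 3O + 6S. The first says that the factor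
3 has slack where disagreements meet, the second that the factor drops to 3/2 unless S is large. If
no cluster is x-good-on-average, Cauchy–Schwarz in each cluster gives xS ≤ D (`sum_sq_dis_ge`).
Three times the first inequality plus x times the second eliminates D and S: (2x + 3)A ≤ (3x + 9)O.
This is the ratio 3 - x/(2x/3 + 1), slightly stronger than the stated one at x = ε².

For the running time, edges are deleted in place in constant time: the last slot of the other
endpoint is moved into the freed slot and one cross pointer is redirected (`AdjStored.deleteEdge`).
Vertices are removed from the vertex list by the same swap with the last entry (`VertStored.erase`).
All randomness is in the first instruction, so after it the execution is deterministic for each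
pivot (`exec_pivot`), and the law of the output is an image of the uniform law on vertices. -/

namespace CorrClust

/-! ### Costs as sums over ordered pairs, and a bound on the optimum after a pivot. -/

section Counting

open Classical in
/-- A set of unordered pairs without loops is counted by ordered pairs. -/
theorem two_mul_ncard_sym2 {V : Type*} [Fintype V] (E : Set (Sym2 V)) (hE : ∀ v, s(v, v) ∉ E) :
    (2 * E.ncard : ℤ) = ∑ v, ∑ w, if s(v, w) ∈ E then 1 else 0 := by
  -- A loopless set of pairs is the edge set of a simple graph, so the handshake lemma applies.
  obtain ⟨H, rfl⟩ : ∃ H : SimpleGraph V, H.edgeSet = E := by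
    refine ⟨SimpleGraph.fromEdgeSet E, ?_⟩
    rw [SimpleGraph.edgeSet_fromEdgeSet, sdiff_eq_left, Set.disjoint_left]
    intro e he hd
    induction e with
    | h a b =>
      obtain rfl : a = b := by simpa using hd
      exact hE a he
  have h := H.sum_degrees_eq_twice_card_edges
  rw [← Set.ncard_coe_finset, SimpleGraph.coe_edgeFinset] at h
  have h' : (2 * (H.edgeSet.ncard : ℤ)) = ∑ v, (H.degree v : ℤ) := by exact_mod_cast h.symm
  rw [h']
  refine Finset.sum_congr rfl fun v _ => ?_
  simp only [← SimpleGraph.card_neighborFinset_eq_degree, SimpleGraph.mem_edgeSet,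
    Finset.sum_boole]
  congr 2
  ext w
  simp

variable {V : Type*} [Fintype V] [DecidableEq V]

/-- The expectation under an image law. -/
theorem expect_map {α β : Type*} [Fintype α] [Fintype β] (p : PMF α) (g : α → β) (f : β → ℝ) :
    expect (p.map g) f = expect p (fun a => f (g a)) := by
  classical
  unfold expect
  have h : ∀ b, (p.map g b).toReal = ∑ a, if b = g a then (p a).toReal else 0 := by
    intro b
    rw [PMF.map_apply, tsum_fintype, ENNReal.toReal_sum]
    · exact Finset.sum_congr rfl fun a _ => by split_ifs <;> simp
    · intro a _
      split_ifs
      · exact p.apply_ne_top a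
      · simp
  simp_rw [h, Finset.sum_mul]
  rw [Finset.sum_comm]
  refine Finset.sum_congr rfl fun a _ => ?_
  simp [ite_mul]

theorem expect_pivotStep [Nonempty V] (G : SimpleGraph V) (f : Finset V → ℝ) :
    expect (pivotStep G) f = (Fintype.card V : ℝ)⁻¹ * ∑ u, f (nbhd G u) := by
  rw [pivotStep, expect_map, expect, Finset.mul_sum]
  exact Finset.sum_congr rfl fun u _ => by simp [PMF.uniformOfFintype_apply]

/-- Two vertices belong to a common cluster. -/
def Together (P : Clustering V) (v w : V) : Prop := ∃ C ∈ P.parts, v ∈ C ∧ w ∈ C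

theorem Together.refl (P : Clustering V) (v : V) : Together P v v := by
  obtain ⟨C, hC, hv⟩ := P.exists_mem (Finset.mem_univ v)
  exact ⟨C, hC, hv, hv⟩

theorem Together.symm {P : Clustering V} {v w : V} (h : Together P v w) : Together P w v := by
  obtain ⟨C, hC, hv, hw⟩ := h
  exact ⟨C, hC, hw, hv⟩

theorem Together.trans {P : Clustering V} {u v w : V} (h : Together P u v)
    (h' : Together P v w) : Together P u w := by
  obtain ⟨C, hC, hu, hv⟩ := h
  obtain ⟨D, hD, hv', hw⟩ := h'
  obtain rfl := P.eq_of_mem_parts hC hD hv hv'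
  exact ⟨C, hC, hu, hw⟩

open Classical in
/-- The indicator of a violated constraint, where `S` says which pairs are clustered together. -/
noncomputable def dis (G : SimpleGraph V) (S : V → V → Prop) (v w : V) : ℤ :=
  if v ≠ w ∧ (G.Adj v w ↔ ¬ S v w) then 1 else 0

theorem two_mul_cost (G : SimpleGraph V) (P : Clustering V) :
    (2 * cost G P : ℤ) = ∑ v, ∑ w, dis G (Together P) v w := by
  classical
  rw [cost, Nat.cast_add, mul_add, two_mul_ncard_sym2, two_mul_ncard_sym2,
    ← Finset.sum_add_distrib]
  · refine Finset.sum_congr rfl fun v _ => ?_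
    rw [← Finset.sum_add_distrib]
    refine Finset.sum_congr rfl fun w _ => ?_
    have : ∀ C : Finset V, (∀ x ∈ s(v, w), x ∈ C) ↔ v ∈ C ∧ w ∈ C := by simp
    simp only [Set.mem_ofPred_eq, this, SimpleGraph.mem_edgeSet, SimpleGraph.compl_adj, dis]
    have hT : (∃ C ∈ P.parts, v ∈ C ∧ w ∈ C) ↔ Together P v w := Iff.rfl
    simp only [hT]
    by_cases hvw : v = w
    · subst hvw; simp
    · by_cases h1 : G.Adj v w <;> by_cases h2 : Together P v w <;> simp [hvw, h1, h2]
  · simp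
  · simp

open Classical in
/-- The indicator of a constraint that is violated by the pivot cluster of `u`. -/
noncomputable def algDis (G : SimpleGraph V) (u v w : V) : ℤ :=
  if (G.Adj v w ∧ ¬ (v ∈ nbhd G u ↔ w ∈ nbhd G u)) ∨
    (v ≠ w ∧ ¬ G.Adj v w ∧ v ∈ nbhd G u ∧ w ∈ nbhd G u) then 1 else 0

theorem two_mul_stepCost (G : SimpleGraph V) (u : V) :
    (2 * stepCost G (nbhd G u) : ℤ) = ∑ v, ∑ w, algDis G u v w := by
  classical
  rw [stepCost, Nat.cast_add, mul_add, two_mul_ncard_sym2, two_mul_ncard_sym2,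
    ← Finset.sum_add_distrib]
  · refine Finset.sum_congr rfl fun v _ => ?_
    rw [← Finset.sum_add_distrib]
    refine Finset.sum_congr rfl fun w _ => ?_
    simp only [Set.mem_ofPred_eq, SimpleGraph.mem_edgeSet, SimpleGraph.compl_adj, algDis,
      Sym2.mem_iff, forall_eq_or_imp, forall_eq, exists_eq_or_imp, exists_eq_left]
    by_cases hvw : v = w
    · subst hvw; simp
    · by_cases h1 : G.Adj v w <;> by_cases h2 : v ∈ nbhd G u <;> by_cases h3 : w ∈ nbhd G u <;>
        simp [hvw, h1, h2, h3]
  · simp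
  · simp

/-- A clustering from an equivalence relation. -/
theorem exists_clustering_together {W : Type*} [Fintype W] [DecidableEq W] (r : Setoid W) :
    ∃ Q : Clustering W, ∀ v w, Together Q v w ↔ r v w := by
  classical
  refine ⟨Finpartition.ofSetoid r, fun v w => ?_⟩
  constructor
  · rintro ⟨C, hC, hv, hw⟩
    rw [← (Finpartition.ofSetoid r).part_eq_of_mem hC hv, Finpartition.mem_part_ofSetoid_iff_rel]
      at hw
    exact hw
  · intro h
    exact ⟨(Finpartition.ofSetoid r).part v,
      (Finpartition.ofSetoid r).part_mem.2 (Finset.mem_univ v),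
      (Finpartition.ofSetoid r).mem_part (Finset.mem_univ v),
      Finpartition.mem_part_ofSetoid_iff_rel.2 h⟩

/-- The clustering used on the graph that remains after pivot `u`: the old one, except that the
rest of the cluster of `u` is broken into singletons. -/
def restTogether (P : Clustering V) (u v w : V) : Prop :=
  v = w ∨ (Together P v w ∧ ¬ Together P u v)

open Classical in
/-- The decrease of the violation of the pair `v, w` after pivot `u`. -/
noncomputable def optDis (G : SimpleGraph V) (P : Clustering V) (u v w : V) : ℤ :=
  dis G (Together P) v w -
    if v ∉ nbhd G u ∧ w ∉ nbhd G u then dis G (restTogether P u) v w else 0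

/-- `restTogether` is an equivalence relation on the surviving vertices, hence gives a feasible
clustering there; its cost bounds the remaining optimum from above, while `P` attains the optimum of
`G`. -/
theorem sum_optDis_le (G : SimpleGraph V) (P : Clustering V) (hP : IsOptimal G P) (u : V) :
    ((∑ v, ∑ w, optDis G P u v w : ℤ) : ℝ) ≤ 2 * optDecrease G (nbhd G u) := by
  classical
  have h1 : optCost G = cost G P := by
    refine le_antisymm (Nat.sInf_le ⟨P, rfl⟩) ?_
    refine le_csInf (Set.range_nonempty_iff_nonempty.2 ⟨P⟩) ?_
    rintro _ ⟨Q, rfl⟩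
    exact hP Q
  let r : Setoid {v : V // v ∉ nbhd G u} :=
    { r := fun v w => restTogether P u v w
      iseqv :=
        { refl := fun v => Or.inl rfl
          symm := by
            rintro v w (h | ⟨h, h'⟩)
            · exact Or.inl h.symm
            · exact Or.inr ⟨h.symm, fun h'' => h' (h''.trans h.symm)⟩
          trans := by
            rintro v w x (h | ⟨h, h'⟩) (k | ⟨k, k'⟩)
            · exact Or.inl (h.trans k)
            · rw [restTogether, h]; exact Or.inr ⟨k, k'⟩
            · rw [restTogether, ← k]; exact Or.inr ⟨h, h'⟩
            · exact Or.inr ⟨h.trans k, h'⟩ } }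
  obtain ⟨Q, hQ⟩ := exists_clustering_together r
  have h2 : optCost (remaining G (nbhd G u)) ≤ cost (remaining G (nbhd G u)) Q :=
    Nat.sInf_le ⟨Q, rfl⟩
  have h3 := two_mul_cost (remaining G (nbhd G u)) Q
  have h4 : ∑ v, ∑ w, dis (remaining G (nbhd G u)) (Together Q) v w =
      ∑ v, ∑ w, if v ∉ nbhd G u ∧ w ∉ nbhd G u then dis G (restTogether P u) v w else 0 := by
    have hsub : ∀ f : V → ℤ, ∑ v : {v : V // v ∉ nbhd G u}, f v =
        ∑ v, if v ∉ nbhd G u then f v else 0 := by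
      intro f
      rw [← Finset.sum_filter]
      exact (Finset.sum_subtype _ (by simp) f).symm
    have hd : ∀ v w : {v : V // v ∉ nbhd G u}, dis (remaining G (nbhd G u)) (Together Q) v w =
        dis G (restTogether P u) v w := by
      intro v w
      have := hQ v w
      simp only [dis, this, SimpleGraph.comap_adj, ne_eq, Subtype.ext_iff]
      rfl
    simp_rw [hd]
    have hin : ∀ v : {v : V // v ∉ nbhd G u}, ∑ w : {v : V // v ∉ nbhd G u},
        dis G (restTogether P u) v w =
        ∑ w, if w ∉ nbhd G u then dis G (restTogether P u) v w else 0 :=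
      fun v => hsub (fun w => dis G (restTogether P u) v w)
    rw [Finset.sum_congr rfl fun v _ => hin v]
    rw [hsub (fun v => ∑ w, if w ∉ nbhd G u then dis G (restTogether P u) v w else 0)]
    refine Finset.sum_congr rfl fun v _ => ?_
    split_ifs with hv
    · simp [hv]
    · simp [hv]
  have h5 : ∑ v, ∑ w, optDis G P u v w =
      2 * (cost G P : ℤ) - 2 * (cost (remaining G (nbhd G u)) Q : ℤ) := by
    rw [h3, h4, two_mul_cost]
    simp only [optDis, Finset.sum_sub_distrib]
  have h6 : (optCost (remaining G (nbhd G u)) : ℝ) ≤ cost (remaining G (nbhd G u)) Q := by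
    exact_mod_cast h2
  rw [h5, optDecrease, h1]
  push_cast
  linarith

end Counting

/-! ### Triple inequalities and the approximation ratio. -/

section Counting

/-- Rotating the arguments does not change a sum over all triples, so charges may be moved freely
among the three rotations of a triple. -/
theorem sum_le_sum_of_cyclic {V : Type*} [Fintype V] (f g : V → V → V → ℤ)
    (h : ∀ u v w, f u v w + f v w u + f w u v ≤ g u v w + g v w u + g w u v) :
    ∑ u, ∑ v, ∑ w, f u v w ≤ ∑ u, ∑ v, ∑ w, g u v w := by
  have cyc : ∀ k : V → V → V → ℤ,
      ∑ u, ∑ v, ∑ w, (k u v w + k v w u + k w u v) = 3 * ∑ u, ∑ v, ∑ w, k u v w := by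
    intro k
    have h1 : ∑ u, ∑ v, ∑ w, k v w u = ∑ u, ∑ v, ∑ w, k u v w :=
      Finset.sum_comm.trans (Finset.sum_congr rfl fun v _ => Finset.sum_comm)
    have h2 : ∑ u, ∑ v, ∑ w, k w u v = ∑ u, ∑ v, ∑ w, k u v w :=
      (Finset.sum_congr rfl fun u _ => Finset.sum_comm).trans Finset.sum_comm
    simp only [Finset.sum_add_distrib, h1, h2]
    ring
  have hfg : ∑ u, ∑ v, ∑ w, (f u v w + f v w u + f w u v) ≤
      ∑ u, ∑ v, ∑ w, (g u v w + g v w u + g w u v) :=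
    Finset.sum_le_sum fun u _ => Finset.sum_le_sum fun v _ => Finset.sum_le_sum fun w _ => h u v w
  rw [cyc, cyc] at hfg
  linarith

variable {V : Type*} [Fintype V] [DecidableEq V]

open Classical in
/-- The indicator of belonging to the same cluster. -/
noncomputable def same (P : Clustering V) (v w : V) : ℤ := if Together P v w then 1 else 0

theorem mem_nbhd {G : SimpleGraph V} {u v : V} : v ∈ nbhd G u ↔ v = u ∨ G.Adj u v := by
  simp [nbhd]

/-- `algDis` is nonzero only on triples spanning exactly two edges. There its three rotations are
all 1, and those of `optDis` add up to the number m of disagreeing pairs, with 1 ≤ m ≤ 3. The first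
inequality becomes 3 + m(m - 1) ≤ 3m. The second is 6 ≤ 3m if m ≥ 2; if m = 1, the disagreeing pair
shares a vertex with a pair in a common cluster, which supplies the missing 3. On an independent
triple inside one cluster, `optDis` is positive only because `restTogether` breaks the cluster up.
Triples with repeated vertices also occur in the sums and are checked separately. -/
theorem triple_inequalities (G : SimpleGraph V) (P : Clustering V) (u v w : V) :
    (algDis G u v w + 2 * (dis G (Together P) u v * dis G (Together P) u w)) +
    (algDis G v w u + 2 * (dis G (Together P) v w * dis G (Together P) v u)) +
    (algDis G w u v + 2 * (dis G (Together P) w u * dis G (Together P) w v)) ≤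
      3 * optDis G P u v w + 3 * optDis G P v w u + 3 * optDis G P w u v ∧
    2 * algDis G u v w + 2 * algDis G v w u + 2 * algDis G w u v ≤
      (3 * optDis G P u v w + 3 *
        (dis G (Together P) u v * same P u w + dis G (Together P) u w * same P u v)) +
      (3 * optDis G P v w u + 3 *
        (dis G (Together P) v w * same P v u + dis G (Together P) v u * same P v w)) +
      (3 * optDis G P w u v + 3 *
        (dis G (Together P) w u * same P w v + dis G (Together P) w v * same P w u)) := by
  classical
  have hs : ∀ x y, Together P x y ↔ Together P y x := fun x y => ⟨.symm, .symm⟩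
  have hvu := hs v u
  have hwv := hs w v
  have hwu := hs w u
  have avu := G.adj_comm v u
  have awv := G.adj_comm w v
  have awu := G.adj_comm w u
  have t1 : Together P u v → Together P v w → Together P u w := .trans
  have t2 : Together P u v → Together P u w → Together P v w := fun h k => h.symm.trans k
  have t3 : Together P u w → Together P v w → Together P u v := fun h k => h.trans k.symm
  have hr := Together.refl P
  by_cases e1 : u = v
  · subst e1
    by_cases e2 : u = w
    · subst e2
      simp [algDis, optDis, dis, same]
    · by_cases a1 : G.Adj u w <;> by_cases s1 : Together P u w <;>
      simp [algDis, optDis, dis, same, restTogether, mem_nbhd, hwu, awu, a1, s1, e2, Ne.symm e2, hr]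
  by_cases e2 : u = w
  · subst e2
    by_cases a1 : G.Adj u v <;> by_cases s1 : Together P u v <;>
      simp [algDis, optDis, dis, same, restTogether, mem_nbhd, hvu, avu, a1, s1, e1, Ne.symm e1, hr]
  by_cases e3 : v = w
  · subst e3
    by_cases a1 : G.Adj u v <;> by_cases s1 : Together P u v <;>
      simp [algDis, optDis, dis, same, restTogether, mem_nbhd, hvu, avu, a1, s1, e1, Ne.symm e1, hr]
  by_cases s1 : Together P u v <;> by_cases s2 : Together P u w <;>
  by_cases s3 : Together P v w <;>
  first
  | exact absurd (t1 s1 s3) s2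
  | exact absurd (t2 s1 s2) s3
  | exact absurd (t3 s2 s3) s1
  | by_cases a1 : G.Adj u v <;> by_cases a2 : G.Adj u w <;> by_cases a3 : G.Adj v w <;>
    simp [algDis, optDis, dis, same, restTogether, mem_nbhd, hvu, hwv, hwu, avu, awv, awu,
      a1, a2, a3, s1, s2, s3, e1, e2, e3, Ne.symm e1, Ne.symm e2, Ne.symm e3]

/-- For fixed `u` the products separate in `v` and `w`, which yields the square of the disagreement
degree and its product with the cluster size; the two symmetric products turn the coefficient 3 into
6. -/
theorem triple_sums (G : SimpleGraph V) (P : Clustering V) :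
    (∑ u, ∑ v, ∑ w, algDis G u v w +
      2 * ∑ u, (∑ v, dis G (Together P) u v) ^ 2 ≤ 3 * ∑ u, ∑ v, ∑ w, optDis G P u v w) ∧
    2 * ∑ u, ∑ v, ∑ w, algDis G u v w ≤ 3 * ∑ u, ∑ v, ∑ w, optDis G P u v w +
      6 * ∑ u, (∑ v, dis G (Together P) u v) * ∑ v, same P u v := by
  have h1 := sum_le_sum_of_cyclic _ (fun u v w => 3 * optDis G P u v w)
    fun u v w => (triple_inequalities G P u v w).1
  have h2 := sum_le_sum_of_cyclic (fun u v w => 2 * algDis G u v w) _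
    fun u v w => (triple_inequalities G P u v w).2
  constructor
  · simp only [Finset.sum_add_distrib, ← Finset.mul_sum] at h1
    simpa only [pow_two, Finset.sum_mul_sum, ← Finset.mul_sum] using h1
  · simp only [Finset.sum_add_distrib, ← Finset.mul_sum, ← Finset.sum_mul] at h2
    have h4 : ∑ u, ∑ v, (∑ w, dis G (Together P) u w) * same P u v =
        ∑ u, (∑ v, dis G (Together P) u v) * ∑ v, same P u v := by
      simp only [← Finset.mul_sum]
    linarith

/-- Since the neighbourhood is closed, `u` lies in both sets and contributes to neither side. -/
theorem sum_dis_eq {G : SimpleGraph V} {P : Clustering V} {C : Finset V} (hC : C ∈ P.parts)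
    {u : V} (hu : u ∈ C) : ∑ v, dis G (Together P) u v = ((nbhd G u ∆ C).card : ℤ) := by
  classical
  have hT : ∀ v, Together P u v ↔ v ∈ C := by
    intro v
    constructor
    · rintro ⟨D, hD, hu', hv⟩
      exact P.eq_of_mem_parts hC hD hu hu' ▸ hv
    · intro hv
      exact ⟨C, hC, hu, hv⟩
  simp only [dis]
  rw [Finset.sum_boole]
  congr 2
  ext v
  simp only [Finset.mem_filter, Finset.mem_univ, true_and, Finset.mem_symmDiff, mem_nbhd, hT]
  by_cases h : v = u
  · subst h; simp [hu]
  · have h' : u ≠ v := fun e => h e.symm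
    by_cases h1 : G.Adj u v <;> by_cases h2 : v ∈ C <;> simp [h, h', h1, h2]

theorem sum_same_eq {P : Clustering V} {C : Finset V} (hC : C ∈ P.parts)
    {u : V} (hu : u ∈ C) : ∑ v, same P u v = (C.card : ℤ) := by
  classical
  simp only [same]
  rw [Finset.sum_boole]
  congr 2
  ext v
  simp only [Finset.mem_filter, Finset.mem_univ, true_and]
  constructor
  · rintro ⟨D, hD, hu', hv⟩
    exact P.eq_of_mem_parts hC hD hu hu' ▸ hv
  · intro hv
    exact ⟨C, hC, hu, hv⟩

/-- If no cluster is good on average then the squares of the disagreement degrees dominate. -/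
theorem sum_sq_dis_ge {G : SimpleGraph V} {P : Clustering V} {x : ℝ}
    (h : ∀ C ∈ P.parts, ¬ GoodOnAverage G x C) :
    x * ((∑ u, (∑ v, dis G (Together P) u v) * ∑ v, same P u v : ℤ) : ℝ) ≤
      ((∑ u, (∑ v, dis G (Together P) u v) ^ 2 : ℤ) : ℝ) := by
  have hsum : ∀ f : V → ℝ, ∑ u, f u = ∑ C ∈ P.parts, ∑ u ∈ C, f u := by
    intro f
    conv_lhs => rw [← P.biUnion_parts]
    exact Finset.sum_biUnion P.disjoint
  push_cast
  rw [hsum, hsum, Finset.mul_sum]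
  refine Finset.sum_le_sum fun C hC => ?_
  have hd : ∀ u ∈ C, (∑ v, (dis G (Together P) u v : ℝ)) = ((nbhd G u ∆ C).card : ℝ) := by
    intro u hu
    exact_mod_cast sum_dis_eq (G := G) hC hu
  have hs : ∀ u ∈ C, (∑ v, (same P u v : ℝ)) = (C.card : ℝ) := by
    intro u hu
    exact_mod_cast sum_same_eq hC hu
  have e1 : ∑ u ∈ C, (∑ v, (dis G (Together P) u v : ℝ)) * ∑ v, (same P u v : ℝ) =
      (∑ u ∈ C, ((nbhd G u ∆ C).card : ℝ)) * C.card := by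
    rw [Finset.sum_mul]
    exact Finset.sum_congr rfl fun u hu => by rw [hd u hu, hs u hu]
  have e2 : ∑ u ∈ C, (∑ v, (dis G (Together P) u v : ℝ)) ^ 2 =
      ∑ u ∈ C, ((nbhd G u ∆ C).card : ℝ) ^ 2 :=
    Finset.sum_congr rfl fun u hu => by rw [hd u hu]
  rw [e1, e2]
  have hg := h C hC
  rw [GoodOnAverage, not_le] at hg
  push_cast at hg
  have hcs : (∑ u ∈ C, ((nbhd G u ∆ C).card : ℝ)) ^ 2 ≤
      C.card * ∑ u ∈ C, ((nbhd G u ∆ C).card : ℝ) ^ 2 := sq_sum_le_card_mul_sum_sq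
  have hpos : (0 : ℝ) < C.card := by
    exact_mod_cast Finset.card_pos.2 (P.nonempty_of_mem_parts hC)
  have hk : (0 : ℝ) ≤ ∑ u ∈ C, ((nbhd G u ∆ C).card : ℝ) :=
    Finset.sum_nonneg fun _ _ => Nat.cast_nonneg _
  set k := ∑ u ∈ C, ((nbhd G u ∆ C).card : ℝ)
  -- After multiplication by |C|, the failure of goodness gives x|C|² < k, and Cauchy–Schwarz bounds
  -- k² by |C| times the sum of squares.
  refine le_of_mul_le_mul_left ?_ hpos
  calc (C.card : ℝ) * (x * (k * C.card)) = k * (x * (C.card : ℝ) ^ 2) := by ring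
    _ ≤ k * k := mul_le_mul_of_nonneg_left hg.le hk
    _ = k ^ 2 := by ring
    _ ≤ _ := hcs

/-- The expected cost of a pivot step when no optimal cluster is good on average. -/
theorem expect_stepCost_le [Nonempty V] (G : SimpleGraph V) {x : ℝ} (hx : 0 ≤ x)
    (P : Clustering V) (hP : IsOptimal G P) (h : ∀ C ∈ P.parts, ¬ GoodOnAverage G x C) :
    expect (pivotStep G) (fun C => (stepCost G C : ℝ)) ≤
      (3 - x / (5 / 6 * x + 1)) * expect (pivotStep G) (optDecrease G) := by
  rw [expect_pivotStep, expect_pivotStep, mul_left_comm]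
  refine mul_le_mul_of_nonneg_left ?_ (by positivity)
  obtain ⟨h1, h2⟩ := triple_sums G P
  have h3 := sum_sq_dis_ge h
  have hX : (2 : ℝ) * ∑ u, (stepCost G (nbhd G u) : ℝ) =
      ((∑ u, ∑ v, ∑ w, algDis G u v w : ℤ) : ℝ) := by
    have : (2 : ℤ) * ∑ u, (stepCost G (nbhd G u) : ℤ) = ∑ u, ∑ v, ∑ w, algDis G u v w := by
      rw [Finset.mul_sum]
      exact Finset.sum_congr rfl fun u _ => two_mul_stepCost G u
    exact_mod_cast this
  have hY : ((∑ u, ∑ v, ∑ w, optDis G P u v w : ℤ) : ℝ) ≤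
      2 * ∑ u, optDecrease G (nbhd G u) := by
    rw [Finset.mul_sum]
    push_cast
    refine Finset.sum_le_sum fun u _ => ?_
    exact_mod_cast sum_optDis_le G P hP u
  have hX0 : (0 : ℝ) ≤ ∑ u, (stepCost G (nbhd G u) : ℝ) :=
    Finset.sum_nonneg fun _ _ => Nat.cast_nonneg _
  have hdd : (0 : ℤ) ≤ ∑ u, (∑ v, dis G (Together P) u v) ^ 2 :=
    Finset.sum_nonneg fun _ _ => sq_nonneg _
  rify at h1 h2 hdd
  push_cast at h3 hX hY
  set X := ∑ u, (stepCost G (nbhd G u) : ℝ)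
  set Z := ∑ u, optDecrease G (nbhd G u)
  set Y := ∑ u, ∑ v, ∑ w, (optDis G P u v w : ℝ)
  set D := ∑ u, (∑ v, (dis G (Together P) u v : ℝ)) ^ 2
  set S := ∑ u, (∑ v, (dis G (Together P) u v : ℝ)) * ∑ v, (same P u v : ℝ)
  rw [← hX] at h1 h2
  -- Three times `h1` plus `x` times `h2`; by `h3` the term 6xS is absorbed by 6D.
  have hkey : (2 * x + 3) * X ≤ (9 + 3 * x) * Z := by
    have := mul_le_mul_of_nonneg_left h2 hx
    have := mul_le_mul_of_nonneg_left hY hx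
    nlinarith
  have hZ : 0 ≤ Z := by nlinarith
  have hden : 0 < 5 / 6 * x + 1 := by positivity
  have heq : 3 - x / (5 / 6 * x + 1) = (9 * x + 18) / (5 * x + 6) := by
    field_simp
    ring
  rw [heq, div_mul_eq_mul_div, le_div_iff₀ (by positivity)]
  have h4 : (5 * x + 6) * ((2 * x + 3) * X) ≤ (5 * x + 6) * ((9 + 3 * x) * Z) :=
    mul_le_mul_of_nonneg_left hkey (by positivity)
  -- The slack of the stated ratio: (2x + 3)(9x + 18) exceeds (5x + 6)(9 + 3x) by exactly 3x².
  have h5 : 0 ≤ x ^ 2 * Z := by positivity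
  have h6 : (2 * x + 3) * (X * (5 * x + 6)) ≤ (2 * x + 3) * ((9 * x + 18) * Z) := by
    nlinarith
  exact le_of_mul_le_mul_left h6 (by positivity)

end Counting

/-! ### Symbolic execution and the pivot program. -/

section Machine

/-- The law of the configuration `n` steps after the configuration `c`. -/
noncomputable def iter (P : Program) : ℕ → Config → PMF Config
  | 0, c => PMF.pure c
  | n + 1, c => (step P c).bind (iter P n)

theorem iter_add (P : Program) (m n : ℕ) (c : Config) :
    iter P (m + n) c = (iter P m c).bind (iter P n) := by
  induction m generalizing c with
  | zero => simp [iter]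
  | succ m ih =>
    rw [Nat.succ_add, iter, iter, PMF.bind_bind]
    exact congrArg _ (funext ih)

/-- `run` appends steps at the end, whereas `iter` prepends them, which is what forward execution
from an arbitrary configuration needs. -/
theorem run_eq_iter (P : Program) (M : Memory) (N : ℕ) : run P M N = iter P N ⟨M, 0, 0⟩ := by
  induction N with
  | zero => rfl
  | succ N ih =>
    rw [run, ih, iter_add]
    congr 1
    funext c
    simp [iter]

theorem iter_of_halted {P : Program} {c : Config} (h : Halted P c) (n : ℕ) :
    iter P n c = PMF.pure c := by
  induction n with
  | zero => rfl
  | succ n ih =>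
    have : P[c.pc]? = none := List.getElem?_eq_none h
    simp [iter, step, this, ih]

/-- `n` deterministic steps lead from `pc` and `M` to `pc'` and `M'`. -/
def Exec (P : Program) (pc : ℕ) (M : Memory) (n pc' : ℕ) (M' : Memory) : Prop :=
  ∀ t, iter P n ⟨M, pc, t⟩ = PMF.pure ⟨M', pc', t + n⟩

variable {P : Program} {pc pc' n : ℕ} {R : ℕ → ℕ} {A : ℕ → ℕ → ℕ} {Q : Memory → Prop}

theorem Exec.trans {pc₁ pc₂ pc₃ m n : ℕ} {M₁ M₂ M₃ : Memory} (h : Exec P pc₁ M₁ m pc₂ M₂)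
    (h' : Exec P pc₂ M₂ n pc₃ M₃) : Exec P pc₁ M₁ (m + n) pc₃ M₃ := by
  intro t
  rw [iter_add, h t, PMF.pure_bind, h' (t + m), add_assoc]

theorem exists_exec_refl {M : Memory} (h : Q M) : ∃ M', Exec P pc M 0 pc M' ∧ Q M' :=
  ⟨M, fun _ => rfl, h⟩

/-- The final memory stays existential and `Q` is deferred, so a chain of these rules computes the
memory by unification and `Q` is proved only once, at the end. -/
theorem exists_exec_of_step {M M₁ : Memory} {pc₁ : ℕ}
    (hs : ∀ t, step P ⟨M, pc, t⟩ = PMF.pure ⟨M₁, pc₁, t + 1⟩)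
    (h : ∃ M', Exec P pc₁ M₁ n pc' M' ∧ Q M') : ∃ M', Exec P pc M (n + 1) pc' M' ∧ Q M' := by
  obtain ⟨M', h, hQ⟩ := h
  refine ⟨M', fun t => ?_, hQ⟩
  rw [iter, hs, PMF.pure_bind, h (t + 1)]
  congr 2
  omega

theorem exists_exec_const {r k : ℕ} (hi : P[pc]? = some (.const r k))
    (h : ∃ M', Exec P (pc + 1) ⟨Function.update R r k, A⟩ n pc' M' ∧ Q M') :
    ∃ M', Exec P pc ⟨R, A⟩ (n + 1) pc' M' ∧ Q M' :=
  exists_exec_of_step (fun t => by simp [step, hi, exec, Config.next, Memory.setReg]) h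

theorem exists_exec_copy {r s : ℕ} (hi : P[pc]? = some (.copy r s))
    (h : ∃ M', Exec P (pc + 1) ⟨Function.update R r (R s), A⟩ n pc' M' ∧ Q M') :
    ∃ M', Exec P pc ⟨R, A⟩ (n + 1) pc' M' ∧ Q M' :=
  exists_exec_of_step (fun t => by simp [step, hi, exec, Config.next, Memory.setReg]) h

theorem exists_exec_inc {r : ℕ} (hi : P[pc]? = some (.inc r))
    (h : ∃ M', Exec P (pc + 1) ⟨Function.update R r (R r + 1), A⟩ n pc' M' ∧ Q M') :
    ∃ M', Exec P pc ⟨R, A⟩ (n + 1) pc' M' ∧ Q M' :=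
  exists_exec_of_step (fun t => by simp [step, hi, exec, Config.next, Memory.setReg]) h

theorem exists_exec_dec {r : ℕ} (hi : P[pc]? = some (.dec r))
    (h : ∃ M', Exec P (pc + 1) ⟨Function.update R r (R r - 1), A⟩ n pc' M' ∧ Q M') :
    ∃ M', Exec P pc ⟨R, A⟩ (n + 1) pc' M' ∧ Q M' :=
  exists_exec_of_step (fun t => by simp [step, hi, exec, Config.next, Memory.setReg]) h

theorem exists_exec_load {r a s : ℕ} (hi : P[pc]? = some (.load r a s))
    (h : ∃ M', Exec P (pc + 1) ⟨Function.update R r (A a (R s)), A⟩ n pc' M' ∧ Q M') :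
    ∃ M', Exec P pc ⟨R, A⟩ (n + 1) pc' M' ∧ Q M' :=
  exists_exec_of_step (fun t => by simp [step, hi, exec, Config.next, Memory.setReg]) h

theorem exists_exec_store {a s r : ℕ} (hi : P[pc]? = some (.store a s r))
    (h : ∃ M', Exec P (pc + 1)
      ⟨R, Function.update A a (Function.update (A a) (R s) (R r))⟩ n pc' M' ∧ Q M') :
    ∃ M', Exec P pc ⟨R, A⟩ (n + 1) pc' M' ∧ Q M' :=
  exists_exec_of_step (fun t => by simp [step, hi, exec, Config.next, Memory.setArr]) h

theorem exists_exec_jumpEq {r s l : ℕ} (hi : P[pc]? = some (.jumpEq r s l)) (hj : R r = R s)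
    (h : ∃ M', Exec P l ⟨R, A⟩ n pc' M' ∧ Q M') :
    ∃ M', Exec P pc ⟨R, A⟩ (n + 1) pc' M' ∧ Q M' :=
  exists_exec_of_step (fun t => by simp [step, hi, exec, hj]) h

theorem exists_exec_jumpEq_ne {r s l : ℕ} (hi : P[pc]? = some (.jumpEq r s l)) (hj : R r ≠ R s)
    (h : ∃ M', Exec P (pc + 1) ⟨R, A⟩ n pc' M' ∧ Q M') :
    ∃ M', Exec P pc ⟨R, A⟩ (n + 1) pc' M' ∧ Q M' :=
  exists_exec_of_step (fun t => by simp [step, hi, exec, hj]) h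

/-- The pivot step. Instructions 0 to 10 write the closed neighbourhood of a random vertex to the
output. The loop at 13 takes the vertices of the output one by one; for each of them the loop at
18 deletes its edges one by one, and then the vertex is removed from the array of vertices. -/
def pivotProgram : Program :=
  [.rand 2 0, .load 2 0 2, .load 3 2 2, .load 4 3 2, .const 1 0,
   .store 6 1 2, .inc 1, .jumpEq 3 4 11, .load 2 4 3, .inc 3, .jumpEq 0 0 5,
   .copy 5 1, .const 6 0,
   .jumpEq 5 6 38, .dec 5, .load 2 6 5, .load 3 2 2, .load 4 3 2,
   .jumpEq 3 4 32, .dec 4, .load 7 4 4, .load 8 5 4, .load 9 3 7, .dec 9, .load 10 4 9,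
   .load 11 5 9, .store 4 8 10, .store 5 8 11, .store 5 11 8, .store 3 7 9, .store 3 2 4,
   .jumpEq 0 0 18,
   .load 3 1 2, .dec 0, .load 4 0 0, .store 0 3 4, .store 1 4 3, .jumpEq 0 0 13]

/-- The registers and arrays after the deletion of one edge. -/
theorem exec_edge (M : Memory) (h : M.reg 3 ≠ M.reg 4) :
    ∃ M', Exec pivotProgram 18 M 14 18 M' ∧
      ((∀ r ∈ [0, 1, 2, 3, 5, 6], M'.reg r = M.reg r) ∧ M'.reg 4 = M.reg 4 - 1 ∧
      (∀ a ∈ [0, 1, 2, 6], M'.arr a = M.arr a) ∧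
      ∃ s w c l, s = M.reg 4 - 1 ∧ w = M.arr 4 s ∧ c = M.arr 5 s ∧ l = M.arr 3 w - 1 ∧
      M'.arr 3 = Function.update (Function.update (M.arr 3) w l) (M.reg 2) s ∧
      M'.arr 4 = Function.update (M.arr 4) c (M.arr 4 l) ∧
      M'.arr 5 = Function.update (Function.update (M.arr 5) c (M.arr 5 l)) (M.arr 5 l) c) := by
  obtain ⟨R, A⟩ := M
  refine exists_exec_jumpEq_ne rfl h ?_
  refine exists_exec_dec rfl ?_
  refine exists_exec_load rfl ?_
  refine exists_exec_load rfl ?_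
  refine exists_exec_load rfl ?_
  refine exists_exec_dec rfl ?_
  refine exists_exec_load rfl ?_
  refine exists_exec_load rfl ?_
  refine exists_exec_store rfl ?_
  refine exists_exec_store rfl ?_
  refine exists_exec_store rfl ?_
  refine exists_exec_store rfl ?_
  refine exists_exec_store rfl ?_
  refine exists_exec_jumpEq rfl rfl ?_
  refine exists_exec_refl ?_
  refine ⟨by simp, by simp, by simp, _, _, _, _, rfl, rfl, rfl, rfl, ?_, ?_, ?_⟩ <;> simp

/-- The registers and arrays after the removal of one vertex from the array of vertices. -/
theorem exec_vertex (M : Memory) :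
    ∃ M', Exec pivotProgram 32 M 6 13 M' ∧
      ((∀ r ∈ [1, 5, 6], M'.reg r = M.reg r) ∧ M'.reg 0 = M.reg 0 - 1 ∧
      (∀ a ∈ [2, 3, 4, 5, 6], M'.arr a = M.arr a) ∧
      ∃ p z, p = M.arr 1 (M.reg 2) ∧ z = M.arr 0 (M.reg 0 - 1) ∧
      M'.arr 0 = Function.update (M.arr 0) p z ∧ M'.arr 1 = Function.update (M.arr 1) z p) := by
  obtain ⟨R, A⟩ := M
  refine exists_exec_load rfl ?_
  refine exists_exec_dec rfl ?_
  refine exists_exec_load rfl ?_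
  refine exists_exec_store rfl ?_
  refine exists_exec_store rfl ?_
  refine exists_exec_jumpEq rfl rfl ?_
  refine exists_exec_refl ?_
  refine ⟨by simp, by simp, by simp, _, _, rfl, rfl, ?_, ?_⟩ <;> simp

/-- The head of the loop over the vertices of the output. -/
theorem exec_head (M : Memory) (h : M.reg 5 ≠ M.reg 6) :
    ∃ M', Exec pivotProgram 13 M 5 18 M' ∧
      ((∀ r ∈ [0, 1, 6], M'.reg r = M.reg r) ∧ M'.reg 5 = M.reg 5 - 1 ∧
      M'.reg 2 = M.arr 6 (M.reg 5 - 1) ∧ M'.reg 3 = M.arr 2 (M'.reg 2) ∧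
      M'.reg 4 = M.arr 3 (M'.reg 2) ∧ M'.arr = M.arr) := by
  obtain ⟨R, A⟩ := M
  refine exists_exec_jumpEq_ne rfl h ?_
  refine exists_exec_dec rfl ?_
  refine exists_exec_load rfl ?_
  refine exists_exec_load rfl ?_
  refine exists_exec_load rfl ?_
  refine exists_exec_refl ?_
  simp

/-- The output of the closed neighbourhood. -/
theorem exec_output (k : ℕ) (M : Memory) (h : M.reg 4 = M.reg 3 + k) :
    ∃ M', Exec pivotProgram 5 M (6 * k + 3) 11 M' ∧
      (M'.reg 0 = M.reg 0 ∧ M'.reg 1 = M.reg 1 + k + 1 ∧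
      (∀ a ≠ 6, M'.arr a = M.arr a) ∧ M'.arr 6 (M.reg 1) = M.reg 2 ∧
      (∀ j < M.reg 1, M'.arr 6 j = M.arr 6 j) ∧
      ∀ j < k, M'.arr 6 (M.reg 1 + 1 + j) = M.arr 4 (M.reg 3 + j)) := by
  induction k generalizing M with
  | zero =>
    obtain ⟨R, A⟩ := M
    refine exists_exec_store rfl ?_
    refine exists_exec_inc rfl ?_
    refine exists_exec_jumpEq rfl (by simpa using h.symm) ?_
    refine exists_exec_refl ?_
    refine ⟨by simp, by simp, fun a ha => by simp [ha], by simp, fun j hj => ?_, by simp⟩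
    simp [hj.ne]
  | succ k ih =>
    -- The loop writes before it tests: register 2 holds the pending vertex, initially the pivot
    -- itself, so `k` slots give `k + 1` outputs.
    have hbody : ∃ M', Exec pivotProgram 5 M 6 5 M' ∧
        (M'.reg 0 = M.reg 0 ∧ M'.reg 1 = M.reg 1 + 1 ∧ M'.reg 3 = M.reg 3 + 1 ∧
        M'.reg 4 = M.reg 4 ∧ M'.reg 2 = M.arr 4 (M.reg 3) ∧ (∀ a ≠ 6, M'.arr a = M.arr a) ∧
        M'.arr 6 = Function.update (M.arr 6) (M.reg 1) (M.reg 2)) := by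
      obtain ⟨R, A⟩ := M
      refine exists_exec_store rfl ?_
      refine exists_exec_inc rfl ?_
      refine exists_exec_jumpEq_ne rfl ?_ ?_
      · have : R 3 ≠ R 4 := by simp only at h; omega
        simpa using this
      refine exists_exec_load rfl ?_
      refine exists_exec_inc rfl ?_
      refine exists_exec_jumpEq rfl rfl ?_
      refine exists_exec_refl ?_
      refine ⟨by simp, by simp, by simp, by simp, by simp, fun a ha => by simp [ha], by simp⟩
    obtain ⟨M₁, hE₁, h0, h1, h3, h4, h2, ha, h6⟩ := hbody
    obtain ⟨M₂, hE₂, k0, k1, ka, ko, kl, kj⟩ := ih M₁ (by omega)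
    have hE := hE₁.trans hE₂
    rw [show 6 + (6 * k + 3) = 6 * (k + 1) + 3 by ring] at hE
    refine ⟨M₂, hE, by omega, by omega, fun a h => (ka a h).trans (ha a h), ?_, ?_, ?_⟩
    · rw [kl _ (by omega), h6]
      simp
    · intro j hj
      rw [kl _ (by omega), h6, Function.update_of_ne hj.ne]
    · intro j hj
      rcases j with _ | j
      · rw [← h1, add_zero, ko, h2]
      · have := kj j (by omega)
        rw [h1, h3, ha 4 (by norm_num)] at this
        rw [show M.reg 1 + 1 + (j + 1) = M.reg 1 + 1 + 1 + j by ring, this]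
        congr 1
        ring

end Machine

/-! ### Deletions in the adjacency arrays and in the vertex list. -/

section DataStructure

variable {V : Type*}

/-- The arrays `F`, `L`, `T`, `X` (first slot, end of the slots, target, cross pointer) store the
adjacency arrays of `H`. -/
structure AdjStored (name : V → ℕ) (H : SimpleGraph V) (F L T X : ℕ → ℕ) : Prop where
  first_le_last : ∀ v, F (name v) ≤ L (name v)
  eq_of_mem : ∀ {v w t}, t ∈ Set.Ico (F (name v)) (L (name v)) →
    t ∈ Set.Ico (F (name w)) (L (name w)) → v = w
  injOn : ∀ v, Set.InjOn T (Set.Ico (F (name v)) (L (name v)))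
  exists_adj : ∀ {v t}, t ∈ Set.Ico (F (name v)) (L (name v)) → ∃ w, H.Adj v w ∧ T t = name w ∧
    X t ∈ Set.Ico (F (name w)) (L (name w)) ∧ T (X t) = name v
  exists_slot : ∀ {v w}, H.Adj v w → ∃ t ∈ Set.Ico (F (name v)) (L (name v)), T t = name w

/-- The arrays `vert` and `pos` list the vertices of the set `A`. -/
structure VertStored (name : V → ℕ) (A : Finset V) (n : ℕ) (vert pos : ℕ → ℕ) : Prop where
  size_eq : n = A.card
  vert_mem : ∀ i < n, ∃ v ∈ A, vert i = name v
  pos_spec : ∀ v ∈ A, pos (name v) < n ∧ vert (pos (name v)) = name v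

/-- The graph `H` without the edges at `v`. -/
def isolate (H : SimpleGraph V) (v : V) : SimpleGraph V where
  Adj x y := H.Adj x y ∧ x ≠ v ∧ y ≠ v
  symm := ⟨fun _ _ h => ⟨h.1.symm, h.2.2, h.2.1⟩⟩
  loopless := ⟨fun _ h => H.loopless.irrefl _ h.1⟩

/-- The graph `G` with only the edges inside `A`. -/
def restr (G : SimpleGraph V) (A : Finset V) : SimpleGraph V where
  Adj x y := G.Adj x y ∧ x ∈ A ∧ y ∈ A
  symm := ⟨fun _ _ h => ⟨h.1.symm, h.2.2, h.2.1⟩⟩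
  loopless := ⟨fun _ h => G.loopless.irrefl _ h.1⟩

theorem isolate_restr [DecidableEq V] (G : SimpleGraph V) (A : Finset V) (v : V) :
    isolate (restr G A) v = restr G (A.erase v) := by
  ext x y
  simp only [isolate, restr, Finset.mem_erase]
  tauto

/-- `pos` is injective on `A` with values below `n = A.card`, hence onto by counting; so `vert` has
no repetitions. -/
theorem VertStored.pos_vert {name : V → ℕ} (hn : Function.Injective name) {A : Finset V} {n : ℕ}
    {vert pos : ℕ → ℕ} (h : VertStored name A n vert pos) {i : ℕ} (hi : i < n) :
    ∃ v ∈ A, vert i = name v ∧ pos (name v) = i := by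
  classical
  have hinj : Set.InjOn (fun v => pos (name v)) A := by
    intro v hv w hw hvw
    apply hn
    rw [← (h.pos_spec v hv).2, ← (h.pos_spec w hw).2]
    exact congrArg vert hvw
  have himg : A.image (fun v => pos (name v)) = Finset.range n := by
    refine Finset.eq_of_subset_of_card_le ?_ ?_
    · intro x hx
      obtain ⟨v, hv, rfl⟩ := Finset.mem_image.1 hx
      exact Finset.mem_range.2 (h.pos_spec v hv).1
    · rw [Finset.card_image_of_injOn hinj, Finset.card_range, h.size_eq]
  obtain ⟨v, hv, rfl⟩ := Finset.mem_image.1 (himg ▸ Finset.mem_range.2 hi)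
  exact ⟨v, hv, (h.pos_spec v hv).2, rfl⟩

/-- Removal of a vertex from the array of vertices. -/
theorem VertStored.erase [DecidableEq V] {name : V → ℕ} (hn : Function.Injective name)
    {A : Finset V} {n : ℕ} {vert pos : ℕ → ℕ} (h : VertStored name A n vert pos) {v : V}
    (hv : v ∈ A) :
    VertStored name (A.erase v) (n - 1) (Function.update vert (pos (name v)) (vert (n - 1)))
      (Function.update pos (vert (n - 1)) (pos (name v))) := by
  obtain ⟨hp, hpv⟩ := h.pos_spec v hv
  obtain ⟨z, hz, hzv, hzp⟩ := h.pos_vert hn (i := n - 1) (by omega)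
  refine ⟨by rw [Finset.card_erase_of_mem hv, ← h.size_eq], fun i hi => ?_, fun a ha => ?_⟩
  · by_cases hip : i = pos (name v)
    · refine ⟨z, Finset.mem_erase.2 ⟨?_, hz⟩, by rw [hip, Function.update_self, hzv]⟩
      rintro rfl
      omega
    · obtain ⟨a, ha, hia, hai⟩ := h.pos_vert hn (i := i) (by omega)
      refine ⟨a, Finset.mem_erase.2 ⟨?_, ha⟩, by rw [Function.update_of_ne hip, hia]⟩
      rintro rfl
      exact hip hai.symm
  · obtain ⟨hav, haA⟩ := Finset.mem_erase.1 ha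
    obtain ⟨h1, h2⟩ := h.pos_spec a haA
    rw [hzv]
    by_cases haz : a = z
    · subst haz
      rw [Function.update_self, Function.update_self]
      refine ⟨?_, rfl⟩
      have : pos (name v) ≠ pos (name a) := fun e => hav (hn (by rw [← h2, ← e, hpv]))
      omega
    · rw [Function.update_of_ne (hn.ne haz)]
      have h3 : pos (name a) ≠ n - 1 := fun e => haz (hn (by rw [← h2, e, hzv]))
      have h4 : pos (name a) ≠ pos (name v) := fun e => hav (hn (by rw [← h2, e, hpv]))
      exact ⟨by omega, by rw [Function.update_of_ne h4, h2]⟩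

section Adjacency

variable {name : V → ℕ} {H : SimpleGraph V} {F L T X : ℕ → ℕ}

theorem AdjStored.isolate_eq_self (h : AdjStored name H F L T X) {v : V}
    (hv : L (name v) = F (name v)) : isolate H v = H := by
  have hno : ∀ w, ¬ H.Adj v w := by
    intro w hw
    obtain ⟨t, ht, -⟩ := h.exists_slot hw
    rw [hv] at ht
    simp at ht
  ext x y
  refine ⟨And.left, fun hxy => ⟨hxy, ?_, ?_⟩⟩
  · rintro rfl; exact hno _ hxy
  · rintro rfl; exact hno _ hxy.symm

/-- The time for a vertex is measured by its current slots, but is charged to its degree in the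
larger graph before the removal. -/
theorem AdjStored.card_slots_le [Fintype V] [DecidableEq V] (h : AdjStored name H F L T X)
    {G : SimpleGraph V} (hG : H ≤ G) (v : V) : L (name v) - F (name v) ≤ deg G v := by
  classical
  have h1 : ((Finset.Ico (F (name v)) (L (name v))).image T).card = L (name v) - F (name v) := by
    rw [Finset.card_image_of_injOn, Nat.card_Ico]
    simpa using h.injOn v
  rw [← h1, deg]
  refine le_trans (Finset.card_le_card ?_) (Finset.card_image_le (f := name))
  intro x hx
  obtain ⟨t, ht, rfl⟩ := Finset.mem_image.1 hx
  obtain ⟨w, hw, hT, -⟩ := h.exists_adj (v := v) (by simpa using ht)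
  exact Finset.mem_image.2 ⟨w, mem_nbhd.2 (Or.inr (hG hw)), hT.symm⟩

/-- Both `t` and `X (X t)` are slots of `v` with the same target, and targets are distinct within an
adjacency array. -/
theorem AdjStored.cross_cross (hn : Function.Injective name) (h : AdjStored name H F L T X)
    {v : V} {t : ℕ} (ht : t ∈ Set.Ico (F (name v)) (L (name v))) : X (X t) = t := by
  obtain ⟨w, -, hT, hX, hTX⟩ := h.exists_adj ht
  obtain ⟨v', -, hT', hX', hTX'⟩ := h.exists_adj hX
  obtain rfl : v = v' := hn (hTX.symm.trans hT')
  exact h.injOn v hX' ht (hTX'.trans hT.symm)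

/-- Deletion of the edge stored in the last slot of `v`: the last slot of the other endpoint `w`
is moved to the slot of this edge. -/
theorem AdjStored.deleteEdge (hn : Function.Injective name) (h : AdjStored name H F L T X)
    {v w : V} {s c l : ℕ} (hlt : F (name v) < L (name v)) (hs : s = L (name v) - 1)
    (hw : T s = name w) (hc : c = X s) (hl : l = L (name w) - 1) :
    AdjStored name (H.deleteEdges {s(v, w)}) F
      (Function.update (Function.update L (name w) l) (name v) s)
      (Function.update T c (T l))
      (Function.update (Function.update X c (X l)) (X l) c) := by
  classical
  have hsv : s ∈ Set.Ico (F (name v)) (L (name v)) := ⟨by omega, by omega⟩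
  obtain ⟨w', hvw, hw', hcw, hTc⟩ := h.exists_adj hsv
  obtain rfl : w = w' := hn (hw.symm.trans hw')
  rw [← hc] at hcw hTc
  have hvw' : v ≠ w := hvw.ne
  have hlw : l ∈ Set.Ico (F (name w)) (L (name w)) := by
    simp only [Set.mem_Ico] at hcw ⊢
    omega
  obtain ⟨y, hwy, hTl, hxy, hTx⟩ := h.exists_adj hlw
  generalize hx : X l = x at *
  have hXc : X c = s := by rw [hc]; exact h.cross_cross hn hsv
  have hXx : X x = l := by rw [← hx]; exact h.cross_cross hn hlw
  have hyw : y ≠ w := hwy.ne'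
  -- The new slots are the old ones except `s` at `v` and `l` at `w`; all further cases use only
  -- this description.
  have hL : ∀ q t, t ∈ Set.Ico (F (name q))
      (Function.update (Function.update L (name w) l) (name v) s (name q)) ↔
      t ∈ Set.Ico (F (name q)) (L (name q)) ∧ (q = v → t ≠ s) ∧ (q = w → t ≠ l) := by
    intro q t
    by_cases hqv : q = v
    · subst hqv
      rw [Function.update_self]
      simp only [Set.mem_Ico, hvw', true_imp_iff, false_imp_iff, and_true]
      omega
    · rw [Function.update_of_ne (hn.ne hqv)]
      by_cases hqw : q = w
      · subst hqw
        rw [Function.update_self]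
        simp only [Set.mem_Ico, hqv, true_imp_iff, false_imp_iff, true_and]
        omega
      · rw [Function.update_of_ne (hn.ne hqw)]
        simp [hqv, hqw]
  have hcl_of : ∀ {t}, t = c → t ≠ l → y ≠ v := by
    rintro t rfl htl rfl
    exact htl (h.injOn w hcw hlw (hTc.trans hTl.symm))
  have hyv_of : c = l → x = s := fun e => by rw [← hx, ← e, hXc]
  have hxs : y = v → x = s := by
    intro e
    refine hyv_of (h.injOn w hcw hlw ?_)
    rw [hTc, hTl, e]
  refine ⟨fun q => ?_, fun {p q t} hp hq => ?_, fun q => ?_, fun {p t} hp => ?_,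
    fun {p q} hpq => ?_⟩
  · by_cases hqv : q = v
    · subst hqv; rw [Function.update_self]; exact hsv.1
    · rw [Function.update_of_ne (hn.ne hqv)]
      by_cases hqw : q = w
      · subst hqw; rw [Function.update_self]; exact hlw.1
      · rw [Function.update_of_ne (hn.ne hqw)]; exact h.first_le_last q
  · exact h.eq_of_mem ((hL p t).1 hp).1 ((hL q t).1 hq).1
  -- Slot `c` now carries the target of `l`, which causes no repetition because `l` has left the
  -- array of `w`.
  · intro t hq t' hq' htt
    obtain ⟨ht, -, htl⟩ := (hL q t).1 hq
    obtain ⟨ht', -, htl'⟩ := (hL q t').1 hq'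
    by_cases e : t = c
    · obtain rfl : q = w := h.eq_of_mem ht (e ▸ hcw)
      by_cases e' : t' = c
      · rw [e, e']
      · rw [e, Function.update_self, Function.update_of_ne e'] at htt
        exact absurd (h.injOn q hlw ht' htt).symm (htl' rfl)
    · by_cases e' : t' = c
      · obtain rfl : q = w := h.eq_of_mem ht' (e' ▸ hcw)
        rw [e', Function.update_self, Function.update_of_ne e] at htt
        exact absurd (h.injOn q ht hlw htt) (htl rfl)
      · rw [Function.update_of_ne e, Function.update_of_ne e'] at htt
        exact h.injOn q ht ht' htt
  · obtain ⟨ht, hts, htl⟩ := (hL p t).1 hp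
    have hdel : ∀ q, H.Adj p q → ¬ (p = v ∧ q = w) → ¬ (p = w ∧ q = v) →
        (H.deleteEdges {s(v, w)}).Adj p q := by
      intro q hq h1 h2
      rw [SimpleGraph.deleteEdges_adj]
      refine ⟨hq, ?_⟩
      simp only [Set.mem_singleton_iff, Sym2.eq_iff]
      tauto
    -- Three kinds of slots remain: `c`, holding the moved edge; `x`, whose cross pointer is
    -- redirected to `c`; and the untouched ones.
    have hxc : x ≠ c := fun e => hyw (h.eq_of_mem hxy (e ▸ hcw))
    by_cases htc : t = c
    · obtain rfl : p = w := h.eq_of_mem ht (htc ▸ hcw)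
      have hyv : y ≠ v := hcl_of htc (htl rfl)
      refine ⟨y, hdel y hwy (fun e => hvw' e.1.symm) (fun e => hyv e.2), ?_, ?_, ?_⟩
      · rw [htc, Function.update_self, hTl]
      · rw [htc, Function.update_of_ne hxc.symm, Function.update_self, hL]
        exact ⟨hxy, fun e => absurd e hyv, fun e => absurd e hyw⟩
      · rw [htc, Function.update_of_ne hxc.symm, Function.update_self, Function.update_of_ne hxc,
          hTx]
    · obtain ⟨q, hpq, hTt, hXt, hTXt⟩ := h.exists_adj ht
      have hXX := h.cross_cross hn ht
      rw [Function.update_of_ne htc]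
      by_cases htx : t = x
      · obtain rfl : p = y := h.eq_of_mem ht (htx ▸ hxy)
        have hpv : p ≠ v := fun e => hts e (htx.trans (hxs e))
        obtain rfl : q = w := hn (hTt.symm.trans (htx ▸ hTx))
        refine ⟨q, hdel q hpq (fun e => hpv e.1) (fun e => hyw e.1), hTt, ?_, ?_⟩
        · rw [htx, Function.update_self, hL]
          refine ⟨hcw, fun e => absurd e.symm hvw', fun _ e => hpv ?_⟩
          exact h.eq_of_mem hxy (hyv_of e ▸ hsv)
        · rw [htx, Function.update_self, Function.update_self, hTl]
      · rw [Function.update_of_ne htx, Function.update_of_ne htc]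
        -- As `X` is an involution on slots, an untouched pointer hitting `s`, `l` or `c` would
        -- force `t` to be `c`, `x` or `s`.
        have hXs : X t ≠ s := fun e => htc (by rw [← hXX, e, hc])
        have hXl : X t ≠ l := fun e => htx (by rw [← hXX, e, hx])
        have hXtc : X t ≠ c := by
          intro e
          have hts' : t = s := by rw [← hXX, e, hXc]
          exact hts (h.eq_of_mem ht (hts' ▸ hsv)) hts'
        refine ⟨q, hdel q hpq ?_ ?_, hTt, ?_, ?_⟩
        · rintro ⟨rfl, rfl⟩
          exact hts rfl (h.injOn p ht hsv (hTt.trans hw.symm))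
        · rintro ⟨rfl, rfl⟩
          exact htc (h.injOn p ht hcw (hTt.trans hTc.symm))
        · rw [hL]
          exact ⟨hXt, fun _ => hXs, fun _ => hXl⟩
        · rw [Function.update_of_ne hXtc, hTXt]
  · rw [SimpleGraph.deleteEdges_adj, Set.mem_singleton_iff, Sym2.eq_iff] at hpq
    obtain ⟨hpq, hne⟩ := hpq
    obtain ⟨t, ht, hTt⟩ := h.exists_slot hpq
    by_cases htl : p = w ∧ t = l
    · obtain ⟨rfl, rfl⟩ := htl
      obtain rfl : y = q := hn (hTl.symm.trans hTt)
      refine ⟨c, (hL _ _).2 ⟨hcw, fun e => absurd e.symm hvw', fun _ e => ?_⟩, ?_⟩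
      · refine hne (Or.inr ⟨rfl, hn ?_⟩)
        rw [← hTt, ← e, hTc]
      · rw [Function.update_self, hTt]
    · refine ⟨t, (hL _ _).2 ⟨ht, fun e e' => hne (Or.inl ⟨e, hn ?_⟩), fun e e' => htl ⟨e, e'⟩⟩, ?_⟩
      · rw [← hTt, e', hw]
      · rw [Function.update_of_ne, hTt]
        rintro rfl
        obtain rfl : p = w := h.eq_of_mem ht hcw
        exact hne (Or.inr ⟨rfl, hn (hTt.symm.trans hTc)⟩)

end Adjacency

end DataStructure

/-! ### Correctness and running time of the program. -/

section Correctness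

variable {V : Type*} {name : V → ℕ}

/-- The inner loop deletes all edges at `v`. -/
theorem exec_isolate (hn : Function.Injective name) (v : V) (k : ℕ) (H : SimpleGraph V)
    (M : Memory) (h2 : M.reg 2 = name v) (h3 : M.reg 3 = M.arr 2 (name v))
    (h4 : M.reg 4 = M.arr 3 (name v)) (hk : M.arr 3 (name v) = M.arr 2 (name v) + k)
    (h : AdjStored name H (M.arr 2) (M.arr 3) (M.arr 4) (M.arr 5)) :
    ∃ M', Exec pivotProgram 18 M (14 * k + 1) 32 M' ∧
      AdjStored name (isolate H v) (M'.arr 2) (M'.arr 3) (M'.arr 4) (M'.arr 5) ∧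
      (∀ r ∈ [0, 1, 2, 5, 6], M'.reg r = M.reg r) ∧ ∀ a ∈ [0, 1, 6], M'.arr a = M.arr a := by
  induction k generalizing H M with
  | zero =>
    rw [h.isolate_eq_self (v := v) (by omega)]
    exact exists_exec_jumpEq rfl (by omega) (exists_exec_refl ⟨h, by simp, by simp⟩)
  | succ k ih =>
    obtain ⟨M₁, hE₁, hr, hr4, ha, s, w, c, l, hs, hw, hc, hl, ha3, ha4, ha5⟩ :=
      exec_edge M (by omega)
    simp only [List.mem_cons, List.not_mem_nil, or_false, forall_eq_or_imp, forall_eq] at hr ha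
    obtain ⟨hr0, hr1, hr2, hr3, hr5, hr6⟩ := hr
    obtain ⟨ha0, ha1, ha2, ha6⟩ := ha
    rw [h4] at hs
    have hlt : M.arr 2 (name v) < M.arr 3 (name v) := by omega
    have hsv : s ∈ Set.Ico (M.arr 2 (name v)) (M.arr 3 (name v)) := ⟨by omega, by omega⟩
    obtain ⟨x, hvx, hTx, -⟩ := h.exists_adj hsv
    rw [hw, hTx] at hl
    have hdel := h.deleteEdge hn hlt hs hTx hc hl
    rw [hw, hTx, h2] at ha3
    rw [← ha2, ← ha3, ← ha4, ← ha5] at hdel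
    have hv3 : M₁.arr 3 (name v) = s := by rw [ha3, Function.update_self]
    obtain ⟨M₂, hE₂, hA, hr', ha'⟩ := ih _ M₁ (by rw [hr2, h2]) (by rw [hr3, h3, ha2])
      (by rw [hv3, hr4, h4, hs]) (by rw [hv3, ha2]; omega) hdel
    simp only [List.mem_cons, List.not_mem_nil, or_false, forall_eq_or_imp, forall_eq] at hr' ha'
    have hE := hE₁.trans hE₂
    rw [show 14 + (14 * k + 1) = 14 * (k + 1) + 1 by ring] at hE
    have hiso : isolate (H.deleteEdges {s(v, x)}) v = isolate H v := by
      ext a b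
      simp only [isolate, SimpleGraph.deleteEdges_adj, Set.mem_singleton_iff, Sym2.eq_iff]
      tauto
    rw [hiso] at hA
    refine ⟨M₂, hE, hA, ?_, ?_⟩
    · simp only [List.mem_cons, List.not_mem_nil, or_false, forall_eq_or_imp, forall_eq]
      exact ⟨hr'.1.trans hr0, hr'.2.1.trans hr1, hr'.2.2.1.trans hr2, hr'.2.2.2.1.trans hr5,
        hr'.2.2.2.2.trans hr6⟩
    · simp only [List.mem_cons, List.not_mem_nil, or_false, forall_eq_or_imp, forall_eq]
      exact ⟨ha'.1.trans ha0, ha'.2.1.trans ha1, ha'.2.2.trans ha6⟩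

variable [Fintype V]

theorem Stores.adjStored {M : Memory} {G : SimpleGraph V} (h : Stores M name G) :
    AdjStored name G (M.arr 2) (M.arr 3) (M.arr 4) (M.arr 5) := by
  refine ⟨h.first_le_last, fun {v w t} hv hw => ?_, h.target_injOn, fun {v t} ht => ?_,
    fun {v w} hvw => ?_⟩
  · by_contra hne
    exact Set.disjoint_left.1 (h.disjoint v w hne) hv hw
  · have : M.target t ∈ name '' G.neighborSet v := h.target_image v ▸ Set.mem_image_of_mem _ ht
    obtain ⟨w, hw, hwt⟩ := this
    obtain ⟨h1, h2⟩ := h.cross_spec v w t ht hwt.symm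
    exact ⟨w, hw, hwt.symm, h1, h2⟩
  · have : name w ∈ M.target '' M.slots (name v) := by
      rw [h.target_image v]
      exact ⟨w, hvw, rfl⟩
    exact this

theorem Stores.vertStored {M : Memory} {G : SimpleGraph V} (h : Stores M name G) :
    VertStored name Finset.univ (M.reg 0) (M.arr 0) (M.arr 1) :=
  ⟨h.size_eq, fun i hi => by simpa using h.vert_mem i hi, fun v _ => h.pos_spec v⟩

/-- The positions of the vertices are uniformly distributed. -/
theorem drawBelow_eq_map [Nonempty V] {M : Memory} {G : SimpleGraph V} (h : Stores M name G) :
    drawBelow (M.reg 0) = (PMF.uniformOfFintype V).map (fun v => M.pos (name v)) := by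
  classical
  have hcard : M.reg 0 = Fintype.card V := h.size_eq
  have hne : (Finset.range (M.reg 0)).Nonempty := by
    rw [Finset.nonempty_range_iff, hcard]
    exact Fintype.card_ne_zero
  have hinj : Function.Injective (fun v => M.pos (name v)) := by
    intro v w hvw
    apply h.name_injective
    rw [← (h.pos_spec v).2, ← (h.pos_spec w).2]
    exact congrArg M.vert hvw
  ext x
  rw [drawBelow, dif_pos hne, PMF.uniformOfFinset_apply, PMF.map_apply, tsum_fintype]
  simp only [Finset.mem_range, Finset.card_range, PMF.uniformOfFintype_apply]
  split_ifs with hx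
  · obtain ⟨v, -, -, hv⟩ := h.vertStored.pos_vert h.name_injective hx
    rw [Finset.sum_eq_single v, if_pos hv.symm, hcard]
    · intro w _ hw
      exact if_neg fun e => hw (hinj (e.symm.trans hv.symm))
    · simp
  · refine (Finset.sum_eq_zero fun v _ => if_neg ?_).symm
    rintro rfl
    exact hx (h.pos_spec v).1

variable [DecidableEq V]

theorem one_le_deg (G : SimpleGraph V) (v : V) : 1 ≤ deg G v :=
  Finset.card_pos.2 ⟨v, mem_nbhd.2 (Or.inl rfl)⟩

/-- The outer loop removes the vertices of the output. -/
theorem exec_removeAll (hn : Function.Injective name) (G : SimpleGraph V) (o : ℕ → V) (i : ℕ)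
    (A : Finset V) (M : Memory) (h5 : M.reg 5 = i) (h6 : M.reg 6 = 0)
    (ho : ∀ j < i, M.arr 6 j = name (o j)) (hinj : Set.InjOn o (Set.Iio i))
    (hoA : ∀ j < i, o j ∈ A)
    (hadj : AdjStored name (restr G A) (M.arr 2) (M.arr 3) (M.arr 4) (M.arr 5))
    (hvert : VertStored name A (M.reg 0) (M.arr 0) (M.arr 1)) :
    ∃ M' n, Exec pivotProgram 13 M n 38 M' ∧ n ≤ 1 + 26 * ∑ j ∈ Finset.range i, deg G (o j) ∧
      AdjStored name (restr G (A \ (Finset.range i).image o))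
        (M'.arr 2) (M'.arr 3) (M'.arr 4) (M'.arr 5) ∧
      VertStored name (A \ (Finset.range i).image o) (M'.reg 0) (M'.arr 0) (M'.arr 1) ∧
      M'.reg 1 = M.reg 1 ∧ M'.arr 6 = M.arr 6 := by
  induction i generalizing A M with
  | zero =>
    obtain ⟨M', hE, rfl⟩ : ∃ M', Exec pivotProgram 13 M 1 38 M' ∧ M' = M :=
      exists_exec_jumpEq rfl (by omega) (exists_exec_refl rfl)
    exact ⟨M', 1, hE, by simp, by simpa using hadj, by simpa using hvert, rfl, rfl⟩
  | succ i ih =>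
    obtain ⟨M₁, hE₁, hr, hr5, hr2, hr3, hr4, ha⟩ := exec_head M (by omega)
    simp only [List.mem_cons, List.not_mem_nil, or_false, forall_eq_or_imp, forall_eq] at hr
    obtain ⟨hr0, hr1, hr6⟩ := hr
    rw [h5, Nat.add_sub_cancel, ho i (Nat.lt_succ_self i)] at hr2
    rw [h5, Nat.add_sub_cancel] at hr5
    rw [hr2, ← ha] at hr3 hr4
    rw [← ha] at hadj hvert ho
    have hle := hadj.first_le_last (o i)
    have hdeg := hadj.card_slots_le (G := G) (fun _ _ h => h.1) (o i)
    have hpos := one_le_deg G (o i)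
    obtain ⟨k, hk⟩ := Nat.exists_eq_add_of_le hle
    obtain ⟨M₂, hE₂, hadj₂, hs, hb⟩ := exec_isolate hn (o i) k _ M₁ hr2 hr3 hr4 hk hadj
    simp only [List.mem_cons, List.not_mem_nil, or_false, forall_eq_or_imp, forall_eq] at hs hb
    obtain ⟨hs0, hs1, hs2, hs5, hs6⟩ := hs
    obtain ⟨hb0, hb1, hb6⟩ := hb
    obtain ⟨M₃, hE₃, ht, ht0, hc, p, z, hp, hz, hc0, hc1⟩ := exec_vertex M₂
    simp only [List.mem_cons, List.not_mem_nil, or_false, forall_eq_or_imp, forall_eq] at ht hc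
    obtain ⟨ht1, ht5, ht6⟩ := ht
    obtain ⟨hc2, hc3, hc4, hc5, hc6⟩ := hc
    rw [← hr0, ← hs0, ← hb0, ← hb1] at hvert
    have hvert₃ := hvert.erase hn (hoA i (Nat.lt_succ_self i))
    rw [hs2, hr2] at hp
    rw [← hp, ← hz, ← hc0, ← hc1, ← ht0] at hvert₃
    rw [isolate_restr, ← hc2, ← hc3, ← hc4, ← hc5] at hadj₂
    have h6eq : M₃.arr 6 = M₁.arr 6 := hc6.trans hb6
    obtain ⟨M₄, n, hE₄, hn₄, hadj₄, hvert₄, h1₄, h6₄⟩ := ih (A.erase (o i)) M₃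
      (by rw [ht5, hs5, hr5]) (by rw [ht6, hs6, hr6, h6])
      (fun j hj => by rw [h6eq]; exact ho j (hj.trans (Nat.lt_succ_self i)))
      (hinj.mono fun j hj => (Set.mem_Iio.1 hj).trans (Nat.lt_succ_self i))
      (fun j hj => Finset.mem_erase.2 ⟨fun e => hj.ne (hinj (hj.trans (Nat.lt_succ_self i))
        (Nat.lt_succ_self i) e), hoA j (hj.trans (Nat.lt_succ_self i))⟩)
      hadj₂ hvert₃
    have hA : A.erase (o i) \ (Finset.range i).image o =
        A \ (Finset.range (i + 1)).image o := by
      rw [Finset.range_add_one, Finset.image_insert]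
      ext x
      simp only [Finset.mem_sdiff, Finset.mem_erase, Finset.mem_insert]
      tauto
    rw [hA] at hadj₄ hvert₄
    refine ⟨M₄, _, ((hE₁.trans hE₂).trans hE₃).trans hE₄, ?_, hadj₄, hvert₄, ?_, ?_⟩
    -- One round takes 5 + (14k + 1) + 6 steps, at most 26 times the degree, since both `k` and 1
    -- are bounded by it.
    · rw [Finset.sum_range_succ]
      omega
    · rw [h1₄, ht1, hs1, hr1]
    · rw [h6₄, h6eq, ha]

/-- The loops work on the fixed type `V` with `restr`, keeping removed vertices as isolated ones;
only here is the result transferred to the subtype. -/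
theorem stores_remaining (hn : Function.Injective name) {M : Memory} {G : SimpleGraph V}
    {C : Finset V} (ha : AdjStored name (restr G (Finset.univ \ C))
      (M.arr 2) (M.arr 3) (M.arr 4) (M.arr 5))
    (hv : VertStored name (Finset.univ \ C) (M.reg 0) (M.arr 0) (M.arr 1)) :
    Stores M (fun v : {v : V // v ∉ C} => name v) (remaining G C) where
  name_injective := hn.comp Subtype.val_injective
  size_eq := by
    rw [Fintype.card_subtype]
    refine hv.size_eq.trans (congrArg _ ?_)
    ext x
    simp
  vert_mem i hi := by
    obtain ⟨v, hvC, h⟩ := hv.vert_mem i hi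
    exact ⟨⟨v, by simpa using hvC⟩, h⟩
  pos_spec v := hv.pos_spec v (by simpa using v.2)
  first_le_last v := ha.first_le_last v
  disjoint v w hne :=
    Set.disjoint_left.2 fun _ h h' => hne (Subtype.ext (ha.eq_of_mem h h'))
  target_injOn v := ha.injOn v
  target_image v := by
    ext x
    constructor
    · rintro ⟨t, ht, rfl⟩
      obtain ⟨w, hw, hT, -⟩ := ha.exists_adj ht
      exact ⟨⟨w, by simpa using hw.2.2⟩, hw.1, hT.symm⟩
    · rintro ⟨w, hw, rfl⟩
      exact ha.exists_slot (v := v.1) (w := w.1) ⟨hw, by simpa using v.2, by simpa using w.2⟩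
  cross_spec v w t ht hT := by
    obtain ⟨w', -, hT', hX, hTX⟩ := ha.exists_adj ht
    obtain rfl : w.1 = w' := hn (hT.symm.trans hT')
    exact ⟨hX, hTX⟩

/-- The deterministic part of the pivot step, after the choice of the pivot `u`. -/
theorem exec_pivot {M : Memory} {G : SimpleGraph V} (h : Stores M name G) (u : V) :
    ∃ M' n, Exec pivotProgram 1 (M.setReg 2 (M.pos (name u))) n 38 M' ∧
      n + 1 ≤ 43 * ∑ v ∈ nbhd G u, deg G v ∧ outCluster name M' = nbhd G u ∧
      (nbhd G u).card = M'.outSize ∧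
      Stores M' (fun v : {v : V // v ∉ nbhd G u} => name v) (remaining G (nbhd G u)) := by
  have hn := h.name_injective
  have hadj := h.adjStored
  have hvert := h.vertStored
  have hload : ∃ M₁, Exec pivotProgram 1 (M.setReg 2 (M.pos (name u))) 4 5 M₁ ∧
      (M₁.reg 0 = M.reg 0 ∧ M₁.reg 1 = 0 ∧ M₁.reg 2 = name u ∧ M₁.reg 3 = M.arr 2 (name u) ∧
      M₁.reg 4 = M.arr 3 (name u) ∧ M₁.arr = M.arr) := by
    have hp : M.arr 0 (M.arr 1 (name u)) = name u := (h.pos_spec u).2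
    obtain ⟨R, A⟩ := M
    refine exists_exec_load rfl ?_
    refine exists_exec_load rfl ?_
    refine exists_exec_load rfl ?_
    refine exists_exec_const rfl ?_
    refine exists_exec_refl ?_
    simp only at hp
    simp [hp]
  obtain ⟨M₁, hE₁, hr0, hr1, hr2, hr3, hr4, ha⟩ := hload
  obtain ⟨k, hk⟩ := Nat.exists_eq_add_of_le (hadj.first_le_last u)
  obtain ⟨M₂, hE₂, hs0, hs1, hb, hb6, -, hbt⟩ := exec_output k M₁ (by rw [hr3, hr4, hk])
  rw [hr1] at hs1 hb6 hbt
  have hreset : ∃ M₃, Exec pivotProgram 11 M₂ 2 13 M₃ ∧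
      (M₃.reg 0 = M₂.reg 0 ∧ M₃.reg 1 = M₂.reg 1 ∧ M₃.reg 5 = M₂.reg 1 ∧ M₃.reg 6 = 0 ∧
      M₃.arr = M₂.arr) := by
    obtain ⟨R, A⟩ := M₂
    refine exists_exec_copy rfl ?_
    refine exists_exec_const rfl ?_
    refine exists_exec_refl ?_
    simp
  obtain ⟨M₃, hE₃, ht0, ht1, ht5, ht6, hc⟩ := hreset
  -- Beyond the `k` slots the value `u` is a dummy that makes the choice total.
  have hslot : ∀ j, ∃ w, j < k → G.Adj u w ∧ M.arr 4 (M.arr 2 (name u) + j) = name w := by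
    intro j
    by_cases hj : j < k
    · obtain ⟨w, hw, hT, -⟩ := hadj.exists_adj (v := u) (t := M.arr 2 (name u) + j)
        ⟨by omega, by omega⟩
      exact ⟨w, fun _ => ⟨hw, hT⟩⟩
    · exact ⟨u, fun h => absurd h hj⟩
  choose q hq using hslot
  -- The output order: the pivot, then its neighbours by slot.
  let o : ℕ → V := fun j => Nat.casesOn j u q
  have ho : ∀ j < k + 1, M₃.arr 6 j = name (o j) := by
    intro j hj
    rw [hc]
    rcases j with _ | j
    · exact hb6.trans hr2
    · have := hbt j (by omega)
      rw [zero_add, add_comm] at this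
      rw [this, ha, hr3]
      exact (hq j (by omega)).2
  have hinj : Set.InjOn o (Set.Iio (k + 1)) := by
    rintro (_ | i) hi (_ | j) hj hij
    · rfl
    · exact absurd hij (hq j (Nat.lt_of_succ_lt_succ hj)).1.ne
    · exact absurd hij (hq i (Nat.lt_of_succ_lt_succ hi)).1.ne'
    · have hi' : i < k := Nat.lt_of_succ_lt_succ hi
      have hj' : j < k := Nat.lt_of_succ_lt_succ hj
      have hij : q i = q j := hij
      have := hadj.injOn u (x₁ := M.arr 2 (name u) + i) (x₂ := M.arr 2 (name u) + j)
        ⟨by omega, by omega⟩ ⟨by omega, by omega⟩ (by rw [(hq i hi').2, (hq j hj').2, hij])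
      omega
  have himg : (Finset.range (k + 1)).image o = nbhd G u := by
    ext x
    rw [Finset.mem_image, mem_nbhd]
    constructor
    · rintro ⟨_ | j, hj, rfl⟩
      · exact Or.inl rfl
      · exact Or.inr (hq j (by simpa using hj)).1
    · rintro (rfl | hx)
      · exact ⟨0, by simp, rfl⟩
      · obtain ⟨t, ht, hT⟩ := hadj.exists_slot hx
        obtain ⟨j, rfl⟩ := Nat.exists_eq_add_of_le ht.1
        have hj : j < k := by
          have := ht.2
          omega
        exact ⟨j + 1, by simpa using hj, hn ((hq j hj).2.symm.trans hT)⟩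
  have hinj' : Set.InjOn o (Finset.range (k + 1)) := by simpa using hinj
  have harr : ∀ a ≠ 6, M₃.arr a = M.arr a := fun a h => by rw [hc, hb a h, ha]
  obtain ⟨M₄, n, hE₄, hn₄, hadj₄, hvert₄, h1₄, h6₄⟩ := exec_removeAll hn G o (k + 1) Finset.univ M₃
    (by rw [ht5, hs1]; omega) ht6 ho hinj (by simp)
    (by
      have : restr G Finset.univ = G := by ext x y; simp [restr]
      rw [this, harr 2 (by norm_num), harr 3 (by norm_num), harr 4 (by norm_num),
        harr 5 (by norm_num)]
      exact hadj)
    (by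
      rw [ht0, hs0, hr0, harr 0 (by norm_num), harr 1 (by norm_num)]
      exact hvert)
  rw [himg] at hadj₄ hvert₄
  have h1 : M₄.reg 1 = k + 1 := by omega
  refine ⟨M₄, _, ((hE₁.trans hE₂).trans hE₃).trans hE₄, ?_, ?_, ?_,
    stores_remaining hn hadj₄ hvert₄⟩
  -- With the random draw the total is at most 11 + 6k + 26Σ, where Σ is the sum of degrees over the
  -- cluster; `k` and 1 are at most Σ, which gives 17 + 26 = 43.
  · have hsum : ∑ v ∈ nbhd G u, deg G v = ∑ j ∈ Finset.range (k + 1), deg G (o j) := by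
      rw [← himg, Finset.sum_image hinj']
    have hk' := hadj.card_slots_le le_rfl u
    have hu : deg G u ≤ ∑ v ∈ nbhd G u, deg G v :=
      Finset.single_le_sum (f := deg G) (fun _ _ => Nat.zero_le _) (mem_nbhd.2 (Or.inl rfl))
    have := one_le_deg G u
    omega
  · ext x
    rw [← himg]
    simp only [outCluster, Memory.outSize, Memory.out, Finset.mem_filter, Finset.mem_univ,
      true_and, Finset.mem_image, Finset.mem_range, h1, h6₄]
    refine exists_congr fun j => and_congr_right fun hj => ?_
    rw [ho j hj, hn.eq_iff]
  · rw [← himg, Finset.card_image_of_injOn hinj', Finset.card_range]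
    exact h1.symm

theorem performsPivotStep [Nonempty V] (G : SimpleGraph V) :
    PerformsPivotStep pivotProgram 43 G := by
  intro name M h
  choose F n hE hn hout hcard hst using exec_pivot h
  -- A time bound common to all pivots; runs that end earlier stay halted.
  let B := ∑ u, n u
  have hrun : run pivotProgram M (B + 1) =
      (PMF.uniformOfFintype V).map (fun u => (⟨F u, 38, 1 + n u⟩ : Config)) := by
    rw [run_eq_iter, iter]
    -- The draw of an index is rewritten as the position of a uniform vertex, so everything
    -- afterwards is a function of `u`.
    have hstep : step pivotProgram ⟨M, 0, 0⟩ = (PMF.uniformOfFintype V).map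
        (fun u => (⟨M.setReg 2 (M.pos (name u)), 1, 1⟩ : Config)) := by
      change (drawBelow (M.reg 0)).map _ = _
      rw [drawBelow_eq_map h, PMF.map_comp]
      rfl
    rw [hstep, PMF.bind_map, ← PMF.bind_pure_comp]
    congr 1
    funext u
    have hle : n u ≤ B := Finset.single_le_sum (fun _ _ => Nat.zero_le _) (Finset.mem_univ u)
    obtain ⟨m, hm⟩ := Nat.exists_eq_add_of_le hle
    rw [Function.comp_apply, Function.comp_apply, hm, iter_add, hE u 1, PMF.pure_bind]
    exact iter_of_halted (le_refl 38) m
  refine ⟨B + 1, ?_, ?_⟩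
  · rw [hrun, PMF.map_comp, pivotStep]
    congr 1
    funext u
    exact hout u
  · intro c hc
    rw [hrun, PMF.support_map] at hc
    obtain ⟨u, -, rfl⟩ := hc
    have e := hout u
    dsimp only
    rw [e]
    refine ⟨le_refl 38, hcard u, ?_, hst u⟩
    have := hn u
    omega

end Correctness

end CorrClust

theorem mainTheorem2 :
    ∃ (prog : CorrClust.Program) (K : ℕ),
      ∀ (V : Type*) [Fintype V] [DecidableEq V] [Nonempty V] (G : SimpleGraph V),
        CorrClust.PerformsPivotStep prog K G ∧
        ∀ (ε : ℝ) (P : CorrClust.Clustering V), CorrClust.IsOptimal G P →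
          (∀ C ∈ P.parts, ¬ CorrClust.GoodOnAverage G (ε ^ 2) C) →
          CorrClust.expect (CorrClust.pivotStep G) (fun C => (CorrClust.stepCost G C : ℝ)) ≤
            (3 - ε ^ 2 / (5 / 6 * ε ^ 2 + 1)) *
              CorrClust.expect (CorrClust.pivotStep G) (CorrClust.optDecrease G) :=
  ⟨CorrClust.pivotProgram, 43, fun _ _ _ _ G => ⟨CorrClust.performsPivotStep G,
    fun ε P hP h => CorrClust.expect_stepCost_le G (sq_nonneg ε) P hP h⟩⟩
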